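/- **Theorem (uniqueness of the channel KL-relative entropy).** For finite non-empty sets $X,Y$, a classical channel $\mathcal M\in\mathrm{CPTP}(X\to Y)$ is a stochastic map: it assigns to every $x\in X$ a probability vector $\mathcal M(|x\rangle\langle x|)$ on $Y$; probability vectors on $Y$ (classical states) are identified with the channels in $\mathrm{CPTP}(1\to Y)$, where $1$ is the one-point system. Let $\mathbb D$ be a function that assigns to every pair of classical channels $\mathcal M,\mathcal N\in\mathrm{CPTP}(X\to Y)$, for all finite $X,Y$, a value $\mathbb D(\mathcal M\|\mathcal N)\in\mathbb R\cup\{\infty\}$, such that 1. ($\mathbb D$ is a classical channel divergence) $\mathbb D(\Theta[\mathcal M]\|\Theta[\mathcal N])\le\mathbb D(\mathcal M\|\mathcal N)$ for all $\mathcal M,\mathcal N\in\mathrm{CPTP}(X\to Y)$ and every superchannel $\Theta[\mathcal M]=\mathcal F\circ(\mathcal M\otimes\mathrm{id}_R)\circ\mathcal E$ with a finite reference system $R$ and classical channels $\mathcal E\in\mathrm{CPTP}(X'\to XR)$, $\mathcal F\in\mathrm{CPTP}(YR\to Y')$; 2. ($\mathbb D$ is weakly additive) $\mathbb D(\mathcal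 M^{\otimes k}\|\mathcal N^{\otimes k})=k\,\mathbb D(\mathcal M\|\mathcal N)$ for all $\mathcal M,\mathcal N\in\mathrm{CPTP}(X\to Y)$ and all integers $k\ge1$ (this holds in particular if $\mathbb D$ is additive under tensor products, i.e. if $\mathbb D$ is a channel relative entropy); 3. ($\mathbb D$ reduces to the Kullback–Leibler divergence on classical states) $\mathbb D(\mathbf p\|\mathbf q)=D(\mathbf p\|\mathbf q)$ for all probability vectors $\mathbf p,\mathbf q$ on the same finite set, where $D(\mathbf p\|\mathbf q)=\sum_y p_y\log_2(p_y/q_y)$ (with $0\log_2(0/q)=0$) if $q_y=0$ implies $p_y=0$ for all $y$, and $D(\mathbf p\|\mathbf q)=\infty$ otherwise; 4. ($\mathbb D$ is continuous in its second argument) for every $\mathcal M\in\mathrm{CPTP}(X\to Y)$ the map $\mathcal N\mapsto\mathbb D(\mathcal M\|\mathcal N)$ from $\mathrm{CPTP}(X\to Y)$ to the extended real line is continuous. Then for all finite non-empty sets $X,Y$ and all classical channels $\mathcal M,\mathcal N\in\mathrm{CPTP}(X\to Y)$ $$\mathbb D(\mathcal M\|\mathcal N)=\max_{x\in X}D\big(\mathcal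 M(|x\rangle\langle x|)\,\big\|\,\mathcal N(|x\rangle\langle x|)\big).$$ -/

import Mathlib

open Finset

namespace ClassicalChannel

/-- A classical channel from `X` to `Y`, i.e. a stochastic map: `M x` is the output distribution
`M(|x⟩⟨x|)`, and `M x y` is the transition probability `M(y|x)`. The topology is that of the
transition probabilities. -/
abbrev Channel (X Y : Type) [Fintype Y] : Type := X → stdSimplex ℝ Y

/-- A classical state (probability vector) as a channel whose input system is trivial. -/
def ofState {Y : Type} [Fintype Y] (p : stdSimplex ℝ Y) : Channel Unit Y := fun _ => p

/-- The action on `M` of the superchannel with pre-processing `E : X' → X ⊗ R`, reference system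
`R` and post-processing `F : Y ⊗ R → Y'`, i.e. `F ∘ (M ⊗ id_R) ∘ E`. -/
def superchannel {X Y X' Y' R : Type} [Fintype X] [Fintype Y] [Fintype Y'] [Fintype R]
    (E : Channel X' (X × R)) (F : Channel (Y × R) Y') (M : Channel X Y) : Channel X' Y' :=
  fun x' => ⟨fun y' => ∑ x, ∑ r, ∑ y, (E x').1 (x, r) * (M x).1 y * (F (y, r)).1 y', by
    refine ⟨fun y' => ?_, ?_⟩
    · exact sum_nonneg fun x _ => sum_nonneg fun r _ => sum_nonneg fun y _ =>
        mul_nonneg (mul_nonneg ((E x').2.1 _) ((M x).2.1 _)) ((F (y, r)).2.1 _)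
    · rw [sum_comm]
      have h : ∀ x, ∑ y', ∑ r, ∑ y, (E x').1 (x, r) * (M x).1 y * (F (y, r)).1 y'
          = ∑ r, (E x').1 (x, r) := by
        intro x
        rw [sum_comm]
        refine sum_congr rfl fun r _ => ?_
        rw [sum_comm]
        simp_rw [← mul_sum, fun y => (F (y, r)).2.2, mul_one, ← mul_sum, (M x).2.2, mul_one]
      simp_rw [h]
      rw [← Fintype.sum_prod_type']
      exact (E x').2.2⟩

/-- The `k`-fold tensor power of a channel. -/
def tensorPower {X Y : Type} [Fintype Y] (M : Channel X Y) (k : ℕ) :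
    Channel (Fin k → X) (Fin k → Y) :=
  fun x => ⟨fun y => ∏ i, (M (x i)).1 (y i), by
    classical
    refine ⟨fun y => prod_nonneg fun i _ => (M (x i)).2.1 _, ?_⟩
    rw [← Fintype.prod_sum (fun i y => (M (x i)).1 y)]
    exact prod_eq_one fun i _ => (M (x i)).2.2⟩

/-- The Kullback–Leibler divergence in bits, `∑ p log₂ (p / q)` if `p ≪ q` and `∞` otherwise. -/
noncomputable def klDivergence {Y : Type} [Fintype Y] (p q : stdSimplex ℝ Y) : EReal :=
  open Classical in
  if ∀ y, q.1 y = 0 → p.1 y = 0 then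
    ((∑ y, p.1 y * Real.logb 2 (p.1 y / q.1 y) : ℝ) : EReal)
  else ⊤

/-- A function of pairs of classical channels with the same input and output systems, over all
finite (nonzero-dimensional) systems. -/
abbrev ChannelFunction : Type 1 :=
  ∀ (X Y : Type) [Fintype X] [Nonempty X] [Fintype Y] [Nonempty Y],
    Channel X Y → Channel X Y → EReal

/-- Classical channel divergences: functions with values in `ℝ ∪ {∞}` that satisfy the data
processing inequality under all superchannels. -/
structure IsChannelDivergence (D : ChannelFunction) : Prop where
  ne_bot : ∀ (X Y : Type) [Fintype X] [Nonempty X] [Fintype Y] [Nonempty Y]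
    (M N : Channel X Y), D X Y M N ≠ ⊥
  dpi : ∀ (X Y X' Y' R : Type) [Fintype X] [Nonempty X] [Fintype Y] [Nonempty Y]
    [Fintype X'] [Nonempty X'] [Fintype Y'] [Nonempty Y'] [Fintype R]
    (E : Channel X' (X × R)) (F : Channel (Y × R) Y') (M N : Channel X Y),
    D X' Y' (superchannel E F M) (superchannel E F N) ≤ D X Y M N

/-- Additivity on tensor powers. -/
def IsWeaklyAdditive (D : ChannelFunction) : Prop :=
  ∀ (X Y : Type) [Fintype X] [Nonempty X] [Fintype Y] [Nonempty Y]
    (M N : Channel X Y) (k : ℕ), 1 ≤ k →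
    D (Fin k → X) (Fin k → Y) (tensorPower M k) (tensorPower N k) = (k : EReal) * D X Y M N

/-- `D` agrees with the Kullback–Leibler divergence on classical states. -/
def ReducesToKL (D : ChannelFunction) : Prop :=
  ∀ (Y : Type) [Fintype Y] [Nonempty Y] (p q : stdSimplex ℝ Y),
    D Unit Y (ofState p) (ofState q) = klDivergence p q

/-- Continuity in the second argument, as a function with values in the extended reals. -/
def IsContinuousInSecond (D : ChannelFunction) : Prop :=
  ∀ (X Y : Type) [Fintype X] [Nonempty X] [Fintype Y] [Nonempty Y] (M : Channel X Y),
    Continuous fun N : Channel X Y => D X Y M N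

end ClassicalChannel

/-!
Restricting a channel to one input is a superchannel, so `D` dominates the divergence of every pair
of outputs. Conversely, suppose `M = ∑ pᵢ Aᵢ` and `∑ qᵢ Aᵢ ≤ N` for channels `Aᵢ`. Preparing the
classical label `i` and then applying `Aᵢ` to the input turns the state pair `(p, q)`, completed by
one label for the remaining part of `N`, into `(M, N)`; hence `D(M‖N) ≤ ∑ pᵢ log₂ (pᵢ / qᵢ)`.

Splitting `M` into a part of mass `1 - ε` below `c N` and a rest of mass `ε` below `b N` gives
`D(M‖N) ≤ 1 + (1 - ε) log₂ c + ε log₂ b`. For tensor powers and `c = aⁿ` with `log₂ a` above all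
the output divergences, Chernoff's bound makes `ε` decay exponentially in `n`, uniformly over the
inputs. Dividing by `n` and letting `n → ∞` leaves `D(M‖N) ≤ log₂ a`.
-/

namespace ClassicalChannel

open Filter
open scoped Topology

lemma mul_logb_div_div_cancel (B w c : ℝ) :
    w * Real.logb B (w / (w / c)) = w * Real.logb B c := by
  rcases eq_or_ne w 0 with h | h
  · simp [h]
  · rw [div_div_cancel₀ h]

lemma exists_pos_forall_le_mul {Y : Type*} [Finite Y] {p q : Y → ℝ} (hq : ∀ y, 0 ≤ q y)
    (hpq : ∀ y, q y = 0 → p y = 0) : ∃ b : ℝ, 0 < b ∧ ∀ y, p y ≤ b * q y := by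
  have hle : ∀ᶠ b in atTop, ∀ y, p y ≤ b * q y := by
    refine eventually_all.2 fun y => ?_
    rcases (hq y).eq_or_lt' with h0 | h0
    · simp [h0, hpq y h0]
    · filter_upwards [eventually_ge_atTop (p y / q y)] with b hb using (div_le_iff₀ h0).1 hb
  exact ((eventually_gt_atTop 0).and hle).exists

section LikelihoodRatio

variable {Y : Type*} [Fintype Y]

/-- The hockey-stick divergence `∑ (p - c q)⁺`, i.e. the mass that has to be removed from `p` to
bring it below `c q`. -/
def hockeyStick (c : ℝ) (p q : Y → ℝ) : ℝ := ∑ y, max (p y - c * q y) 0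

/-- The moment `𝔼_p[(p / q) ^ s]` of the likelihood ratio, which is `2 ^ (s * D)` for `D` the Rényi
divergence of order `1 + s`. Points with `q y = 0` contribute `0` when `s ≠ 0`, so it has this
meaning only if `p` vanishes wherever `q` does. -/
noncomputable def ratioMoment (s : ℝ) (p q : Y → ℝ) : ℝ := ∑ y, p y * (p y / q y) ^ s

lemma sum_min_eq_sub_hockeyStick (c : ℝ) (p q : Y → ℝ) :
    ∑ y, min (p y) (c * q y) = ∑ y, p y - hockeyStick c p q := by
  rw [hockeyStick, ← sum_sub_distrib]
  refine sum_congr rfl fun y _ => ?_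
  rcases le_total (p y) (c * q y) with h | h
  · rw [min_eq_left h, max_eq_right (sub_nonpos.2 h), sub_zero]
  · rw [min_eq_right h, max_eq_left (sub_nonneg.2 h), sub_sub_cancel]

lemma hockeyStick_le_ratioMoment_div {p q : Y → ℝ} (hp : ∀ y, 0 ≤ p y) (hq : ∀ y, 0 ≤ q y)
    (hpq : ∀ y, q y = 0 → p y = 0) {s c : ℝ} (hs : 0 ≤ s) (hc : 0 < c) :
    hockeyStick c p q ≤ ratioMoment s p q / c ^ s := by
  rw [hockeyStick, ratioMoment, sum_div]
  refine sum_le_sum fun y _ => ?_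
  rw [mul_div_assoc, ← Real.div_rpow (div_nonneg (hp y) (hq y)) hc.le]
  have hratio : 0 ≤ p y / q y / c := div_nonneg (div_nonneg (hp y) (hq y)) hc.le
  refine max_le ?_ (mul_nonneg (hp y) (Real.rpow_nonneg hratio s))
  rcases le_or_gt (p y) (c * q y) with h | h
  · exact (sub_nonpos.2 h).trans (mul_nonneg (hp y) (Real.rpow_nonneg hratio s))
  · have hq0 : 0 < q y := (hq y).lt_of_ne' fun h0 => by simp [h0, hpq y h0] at h
    have hone : 1 ≤ p y / q y / c := by
      rw [div_div, one_le_div (by positivity), mul_comm]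
      exact h.le
    calc p y - c * q y ≤ p y := sub_le_self _ (by positivity)
      _ ≤ p y * (p y / q y / c) ^ s :=
        le_mul_of_one_le_right (hp y) (Real.one_le_rpow hone hs)

lemma ratioMoment_nonneg {p q : Y → ℝ} (hp : ∀ y, 0 ≤ p y) (hq : ∀ y, 0 ≤ q y) (s : ℝ) :
    0 ≤ ratioMoment s p q :=
  sum_nonneg fun y _ => mul_nonneg (hp y) (Real.rpow_nonneg (div_nonneg (hp y) (hq y)) s)

lemma ratioMoment_pi {ι : Type*} [Fintype ι] [DecidableEq ι] {κ : ι → Type*}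
    [∀ i, Fintype (κ i)] {p q : ∀ i, κ i → ℝ}
    (hp : ∀ i y, 0 ≤ p i y) (hq : ∀ i y, 0 ≤ q i y) (s : ℝ) :
    ratioMoment s (fun y : ∀ i, κ i => ∏ i, p i (y i)) (fun y => ∏ i, q i (y i)) =
      ∏ i, ratioMoment s (p i) (q i) := by
  simp only [ratioMoment, Fintype.prod_sum]
  refine sum_congr rfl fun y _ => ?_
  rw [← prod_div_distrib, ← Real.finsetProd_rpow _ _ fun i _ => div_nonneg (hp i _) (hq i _),
    ← prod_mul_distrib]

lemma hasDerivAt_ratioMoment_zero {p q : Y → ℝ} (hp : ∀ y, 0 ≤ p y) (hq : ∀ y, 0 ≤ q y)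
    (hpq : ∀ y, q y = 0 → p y = 0) :
    HasDerivAt (fun s => ratioMoment s p q) (∑ y, p y * Real.log (p y / q y)) 0 := by
  refine HasDerivAt.fun_sum fun y _ => ?_
  rcases (hp y).eq_or_lt' with h | h
  · simpa [h] using hasDerivAt_const (0 : ℝ) (0 : ℝ)
  · have hq0 : 0 < q y := (hq y).lt_of_ne' fun h0 => h.ne' (hpq y h0)
    simpa using ((hasDerivAt_id (0 : ℝ)).const_rpow (div_pos h hq0)).const_mul (p y)

lemma eventually_ratioMoment_lt_rpow {p q : Y → ℝ} (hp : ∀ y, 0 ≤ p y) (hq : ∀ y, 0 ≤ q y)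
    (hpq : ∀ y, q y = 0 → p y = 0) (hp1 : ∑ y, p y = 1) {a : ℝ} (ha : 0 < a)
    (h : ∑ y, p y * Real.log (p y / q y) < Real.log a) :
    ∀ᶠ s in 𝓝[>] (0 : ℝ), ratioMoment s p q < a ^ s := by
  have hpow : HasDerivAt (fun s : ℝ => a ^ s) (Real.log a) 0 := by
    simpa using (hasDerivAt_id (0 : ℝ)).const_rpow ha
  have hderiv := hpow.fun_sub (hasDerivAt_ratioMoment_zero hp hq hpq)
  have hsign := eventually_nhdsWithin_sign_eq_of_deriv_pos
    (hderiv.deriv.symm ▸ sub_pos.2 h) (by simp [ratioMoment, hp1])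
  filter_upwards [hsign.filter_mono nhdsWithin_le_nhds, self_mem_nhdsWithin] with s hs hs0
  rw [sub_zero, sign_pos (Set.mem_Ioi.1 hs0), sign_eq_one_iff] at hs
  exact sub_pos.1 hs

end LikelihoodRatio

section FiniteMeasures

variable {Y : Type*} [Fintype Y]

lemma exists_stdSimplex_sum_mul_eq [Nonempty Y] {f : Y → ℝ} (hf : ∀ y, 0 ≤ f y) :
    ∃ p : stdSimplex ℝ Y, ∀ y, (∑ z, f z) * p y = f y := by
  rcases (sum_nonneg fun y _ => hf y : 0 ≤ ∑ y, f y).eq_or_lt' with h0 | h0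
  · obtain ⟨p⟩ : Nonempty (stdSimplex ℝ Y) := inferInstance
    refine ⟨p, fun y => ?_⟩
    rw [h0, zero_mul, (sum_eq_zero_iff_of_nonneg fun y _ => hf y).1 h0 y (mem_univ y)]
  · exact ⟨⟨fun y => f y / ∑ z, f z, fun y => div_nonneg (hf y) h0.le,
      by rw [← sum_div, div_self h0.ne']⟩, fun y => mul_div_cancel₀ _ h0.ne'⟩

lemma exists_le_sum_eq {f : Y → ℝ} (hf : ∀ y, 0 ≤ f y) {w : ℝ} (hw : 0 ≤ w)
    (hwf : w ≤ ∑ y, f y) :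
    ∃ g : Y → ℝ, (∀ y, 0 ≤ g y) ∧ (∀ y, g y ≤ f y) ∧ ∑ y, g y = w := by
  have hf0 : 0 ≤ ∑ y, f y := hw.trans hwf
  refine ⟨fun y => w / (∑ z, f z) * f y, fun y => mul_nonneg (div_nonneg hw hf0) (hf y),
    fun y => mul_le_of_le_one_left (hf y) (div_le_one_of_le₀ hwf hf0), ?_⟩
  rw [← mul_sum, div_mul_cancel_of_imp fun h0 => le_antisymm (hwf.trans_eq h0) hw]

end FiniteMeasures

section Channels

variable {X Y : Type} [Fintype Y]

lemma superchannel_vertex_apply {X' Y' R : Type} [Fintype X] [Fintype Y'] [Fintype R]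
    [DecidableEq X] [DecidableEq R] (e : X' → X × R) (F : Channel (Y × R) Y') (M : Channel X Y)
    (x' : X') (y' : Y') :
    superchannel (fun x' => stdSimplex.vertex (e x')) F M x' y' =
      ∑ y, M (e x').1 y * F (y, (e x').2) y' := by
  change ∑ x, ∑ r, ∑ y, (Pi.single (e x') 1 : X × R → ℝ) (x, r) * M x y * F (y, r) y' = _
  rw [← Fintype.sum_prod_type' fun x r =>
    ∑ y, (Pi.single (e x') 1 : X × R → ℝ) (x, r) * M x y * F (y, r) y']
  simp [Pi.single_apply]

lemma tensorPower_apply (M : Channel X Y) (n : ℕ) (x : Fin n → X) (y : Fin n → Y) :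
    tensorPower M n x y = ∏ i, M (x i) (y i) := rfl

lemma tensorPower_le_pow_mul {M N : Channel X Y} {b : ℝ} (h : ∀ x y, M x y ≤ b * N x y) (n : ℕ)
    (x : Fin n → X) (y : Fin n → Y) : tensorPower M n x y ≤ b ^ n * tensorPower N n x y := by
  simp only [tensorPower_apply]
  calc ∏ i, M (x i) (y i) ≤ ∏ i, b * N (x i) (y i) :=
        prod_le_prod (fun i _ => stdSimplex.zero_le _ _) fun i _ => h _ _
    _ = b ^ n * ∏ i, N (x i) (y i) := by simp [prod_mul_distrib]

lemma tensorPower_eq_zero {M N : Channel X Y} (h : ∀ x y, N x y = 0 → M x y = 0) (n : ℕ)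
    (x : Fin n → X) (y : Fin n → Y) (h0 : tensorPower N n x y = 0) : tensorPower M n x y = 0 := by
  rw [tensorPower_apply] at h0 ⊢
  obtain ⟨i, hi, hNi⟩ := prod_eq_zero_iff.1 h0
  exact prod_eq_zero hi (h _ _ hNi)

lemma hockeyStick_tensorPower_le {M N : Channel X Y} (hMN : ∀ x y, N x y = 0 → M x y = 0)
    {s a ρ : ℝ} (hs : 0 ≤ s) (ha : 0 < a)
    (hρ : ∀ x, ratioMoment s (M x) (N x) ≤ ρ * a ^ s) (n : ℕ) (x : Fin n → X) :
    hockeyStick (a ^ n) (tensorPower M n x) (tensorPower N n x) ≤ ρ ^ n := by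
  have hM : ∀ i y, 0 ≤ M (x i) y := fun i => stdSimplex.zero_le (M (x i))
  have hN : ∀ i y, 0 ≤ N (x i) y := fun i => stdSimplex.zero_le (N (x i))
  have hmoment : ratioMoment s (tensorPower M n x) (tensorPower N n x) ≤ (ρ * a ^ s) ^ n :=
    calc ratioMoment s (tensorPower M n x) (tensorPower N n x)
        = ∏ i, ratioMoment s (M (x i)) (N (x i)) := ratioMoment_pi hM hN s
      _ ≤ (ρ * a ^ s) ^ n := by
        simpa using prod_le_prod (s := univ) (fun i _ => ratioMoment_nonneg (hM i) (hN i) s)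
          fun i _ => hρ (x i)
  calc hockeyStick (a ^ n) (tensorPower M n x) (tensorPower N n x)
      ≤ ratioMoment s (tensorPower M n x) (tensorPower N n x) / (a ^ n) ^ s :=
        hockeyStick_le_ratioMoment_div (stdSimplex.zero_le _) (stdSimplex.zero_le _)
          (tensorPower_eq_zero hMN n x) hs (by positivity)
    _ ≤ (ρ * a ^ s) ^ n / (a ^ n) ^ s := by gcongr
    _ = ρ ^ n := by
        rw [← Real.rpow_pow_comm ha.le, mul_pow, mul_div_cancel_right₀ _ (by positivity)]

lemma klDivergence_of_forall_eq_zero {p q : stdSimplex ℝ Y} (h : ∀ y, q y = 0 → p y = 0) :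
    klDivergence p q = ((∑ y, p y * Real.logb 2 (p y / q y) : ℝ) : EReal) :=
  if_pos h

lemma klDivergence_eq_top {p q : stdSimplex ℝ Y} {y : Y} (hq : q y = 0) (hp : p y ≠ 0) :
    klDivergence p q = ⊤ :=
  if_neg fun h => hp (h y hq)

end Channels

namespace IsChannelDivergence

variable {D : ChannelFunction} (hdiv : IsChannelDivergence D) (hKL : ReducesToKL D)
  {X Y : Type} [Fintype X] [Nonempty X] [Fintype Y] [Nonempty Y] {M N : Channel X Y}
include hdiv hKL

lemma klDivergence_apply_le (M N : Channel X Y) (x : X) :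
    klDivergence (M x) (N x) ≤ D X Y M N := by
  classical
  have hrestrict : ∀ L : Channel X Y, superchannel (fun _ : Unit => stdSimplex.vertex (x, ()))
      (fun y : Y × Unit => stdSimplex.vertex y.1) L = ofState (L x) := by
    intro L
    ext u y
    rw [superchannel_vertex_apply fun _ => (x, ())]
    simp [Pi.single_apply, ofState]
  rw [← hKL, ← hrestrict, ← hrestrict]
  exact hdiv.dpi ..

lemma le_klDivergence {Z : Type} [Fintype Z] [Nonempty Z] {p q : stdSimplex ℝ Z}
    (F : Channel (Z × X) Y) (hM : ∀ x y, ∑ z, p z * F (z, x) y = M x y)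
    (hN : ∀ x y, ∑ z, q z * F (z, x) y = N x y) : D X Y M N ≤ klDivergence p q := by
  classical
  have hprepare : ∀ {r : stdSimplex ℝ Z} {L : Channel X Y},
      (∀ x y, ∑ z, r z * F (z, x) y = L x y) →
      superchannel (fun x => stdSimplex.vertex ((), x)) F (ofState r) = L := by
    intro r L hL
    ext x y
    rw [superchannel_vertex_apply fun x => ((), x)]
    exact hL x y
  rw [← hKL, ← hprepare hM, ← hprepare hN]
  exact hdiv.dpi ..

lemma le_sum_mul_logb_div {ι : Type} [Fintype ι] {p : stdSimplex ℝ ι} {q : ι → ℝ}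
    (hq : ∀ i, 0 ≤ q i) (hpq : ∀ i, q i = 0 → p i = 0) (A : ι → Channel X Y)
    (hM : ∀ x y, ∑ i, p i * A i x y = M x y) (hN : ∀ x y, ∑ i, q i * A i x y ≤ N x y) :
    D X Y M N ≤ ((∑ i, p i * Real.logb 2 (p i / q i) : ℝ) : EReal) := by
  have hrest : ∀ x, ∑ y, (N x y - ∑ i, q i * A i x y) = 1 - ∑ i, q i := by
    intro x
    rw [sum_sub_distrib, sum_comm]
    simp [← mul_sum]
  have hq1 : 0 ≤ 1 - ∑ i, q i := by
    obtain ⟨x⟩ := ‹Nonempty X›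
    rw [← hrest x]
    exact sum_nonneg fun y _ => sub_nonneg.2 (hN x y)
  choose G hG using fun x => exists_stdSimplex_sum_mul_eq fun y => sub_nonneg.2 (hN x y)
  simp only [hrest] at hG
  let p' : stdSimplex ℝ (Option ι) :=
    ⟨fun o => o.elim 0 p, by rintro (_ | i) <;> simp, by simp [Fintype.sum_option]⟩
  let q' : stdSimplex ℝ (Option ι) :=
    ⟨fun o => o.elim (1 - ∑ i, q i) q, by rintro (_ | i) <;> simp [hq, sub_nonneg.1 hq1],
      by simp [Fintype.sum_option]⟩
  have hp' : ∀ o, p' o = o.elim 0 p := fun _ => rfl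
  have hq' : ∀ o, q' o = o.elim (1 - ∑ i, q i) q := fun _ => rfl
  have hle : D X Y M N ≤ klDivergence p' q' :=
    hdiv.le_klDivergence hKL (fun z => z.1.elim (G z.2) fun i => A i z.2)
      (fun x y => by simp [Fintype.sum_option, hp', hM])
      (fun x y => by simp [Fintype.sum_option, hq', hG])
  have hpq' : ∀ o, q' o = 0 → p' o = 0 := by
    rintro (_ | i)
    exacts [fun _ => rfl, hpq i]
  rwa [klDivergence_of_forall_eq_zero hpq', Fintype.sum_option, hp', Option.elim_none, zero_mul,
    zero_add] at hle

lemma le_logb_card_add_sum {ι : Type} [Fintype ι] {f : ι → X → Y → ℝ} {w b : ι → ℝ}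
    (hb : ∀ i, 0 < b i) (hf : ∀ i x y, 0 ≤ f i x y) (hw : ∀ i x, ∑ y, f i x y = w i)
    (hM : ∀ x y, ∑ i, f i x y = M x y) (hN : ∀ i x y, f i x y ≤ b i * N x y) :
    D X Y M N ≤
      ((Real.logb 2 (Fintype.card ι) + ∑ i, w i * Real.logb 2 (b i) : ℝ) : EReal) := by
  let x₀ : X := Classical.arbitrary X
  have hw0 : ∀ i, 0 ≤ w i := fun i => hw i x₀ ▸ sum_nonneg fun y _ => hf i x₀ y
  have hw1 : ∑ i, w i = 1 := by
    simp_rw [← fun i => hw i x₀]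
    rw [sum_comm]
    simp [hM]
  have hι : Nonempty ι := by
    by_contra! h
    simp at hw1
  have hcard : (0 : ℝ) < Fintype.card ι := by exact_mod_cast Fintype.card_pos
  choose A hA using fun i x => exists_stdSimplex_sum_mul_eq (hf i x)
  simp only [hw] at hA
  -- These weights make each of the `|ι|` parts at most `N / |ι|`, so that their sum is at most `N`.
  have hle : D X Y M N ≤
      ((∑ i, w i * Real.logb 2 (w i / (w i / (Fintype.card ι * b i))) : ℝ) : EReal) := by
    refine hdiv.le_sum_mul_logb_div hKL (p := ⟨w, hw0, hw1⟩)
      (q := fun i => w i / (Fintype.card ι * b i)) ?_ ?_ A ?_ ?_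
    · exact fun i => div_nonneg (hw0 i) (mul_pos hcard (hb i)).le
    · exact fun i h => (div_eq_zero_iff.1 h).resolve_right (mul_pos hcard (hb i)).ne'
    · exact fun x y => (sum_congr rfl fun i _ => hA i x y).trans (hM x y)
    · intro x y
      calc ∑ i, w i / (Fintype.card ι * b i) * A i x y
          = ∑ i, f i x y / (Fintype.card ι * b i) := by simp_rw [div_mul_eq_mul_div, hA]
        _ ≤ ∑ _i : ι, N x y / Fintype.card ι := by
          refine sum_le_sum fun i _ => ?_
          rw [div_le_div_iff₀ (mul_pos hcard (hb i)) hcard]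
          nlinarith [hN i x y]
        _ = N x y := by simp [mul_div_cancel₀ _ hcard.ne']
  refine hle.trans_eq (congrArg _ ?_)
  simp_rw [mul_logb_div_div_cancel, Real.logb_mul hcard.ne' (hb _).ne', mul_add]
  rw [sum_add_distrib, ← sum_mul, hw1, one_mul]

lemma le_of_hockeyStick_le {ε b c : ℝ} (hε : ε ≤ 1) (hb : 0 < b) (hc : 0 < c)
    (hMN : ∀ x y, M x y ≤ b * N x y) (hstick : ∀ x, hockeyStick c (M x) (N x) ≤ ε) :
    D X Y M N ≤ ((1 + ((1 - ε) * Real.logb 2 c + ε * Real.logb 2 b) : ℝ) : EReal) := by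
  have hmass : ∀ x, 1 - ε ≤ ∑ y, min (M x y) (c * N x y) := fun x => by
    rw [sum_min_eq_sub_hockeyStick, stdSimplex.sum_eq_one]
    exact sub_le_sub_left (hstick x) 1
  choose g hg0 hgmin hgsum using fun x => exists_le_sum_eq
    (fun y => le_min (stdSimplex.zero_le (M x) y) (mul_nonneg hc.le (stdSimplex.zero_le (N x) y)))
    (sub_nonneg.2 hε) (hmass x)
  have hgM : ∀ x y, g x y ≤ M x y := fun x y => (hgmin x y).trans (min_le_left _ _)
  have hgN : ∀ x y, g x y ≤ c * N x y := fun x y => (hgmin x y).trans (min_le_right _ _)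
  have hle := hdiv.le_logb_card_add_sum hKL (M := M) (N := N)
    (f := fun i x y => bif i then g x y else M x y - g x y)
    (w := fun i => bif i then 1 - ε else ε) (b := fun i => bif i then c else b)
    (by simp [hb, hc]) (by simp [hg0, hgM]) (by simp [hgsum]) (by simp)
    (Bool.forall_bool.2 ⟨fun x y => (sub_le_self _ (hg0 x y)).trans (hMN x y), hgN⟩)
  simpa using hle

lemma natCast_mul_le_of_ratioMoment_le (hadd : IsWeaklyAdditive D) {s a b ρ : ℝ} (hs : 0 ≤ s)
    (ha : 0 < a) (hb : 0 < b) (hρ0 : 0 ≤ ρ) (hρ1 : ρ ≤ 1) (hMN : ∀ x y, M x y ≤ b * N x y)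
    (hρ : ∀ x, ratioMoment s (M x) (N x) ≤ ρ * a ^ s) {n : ℕ} (hn : 1 ≤ n) :
    n * D X Y M N ≤
      ((1 + n * ((1 - ρ ^ n) * Real.logb 2 a + ρ ^ n * Real.logb 2 b) : ℝ) : EReal) := by
  have hac : ∀ x y, N x y = 0 → M x y = 0 := fun x y h =>
    le_antisymm (by simpa [h] using hMN x y) (stdSimplex.zero_le _ _)
  rw [← hadd X Y M N n hn]
  convert hdiv.le_of_hockeyStick_le hKL (pow_le_one₀ hρ0 hρ1) (pow_pos hb n) (pow_pos ha n)
    (tensorPower_le_pow_mul hMN n) (hockeyStick_tensorPower_le hac hs ha hρ n) using 3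
  rw [Real.logb_pow, Real.logb_pow]
  ring

lemma le_logb_of_ratioMoment_le (hadd : IsWeaklyAdditive D) {s a b ρ : ℝ} (hs : 0 ≤ s)
    (ha : 0 < a) (hb : 0 < b) (hρ0 : 0 ≤ ρ) (hρ1 : ρ < 1) (hMN : ∀ x y, M x y ≤ b * N x y)
    (hρ : ∀ x, ratioMoment s (M x) (N x) ≤ ρ * a ^ s) :
    D X Y M N ≤ (Real.logb 2 a : EReal) := by
  have hpow : Tendsto (fun n : ℕ => ρ ^ n) atTop (𝓝 0) :=
    tendsto_pow_atTop_nhds_zero_of_lt_one hρ0 hρ1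
  have hlim : Tendsto
      (fun n : ℕ => 1 / (n : ℝ) + ((1 - ρ ^ n) * Real.logb 2 a + ρ ^ n * Real.logb 2 b)) atTop
      (𝓝 (Real.logb 2 a)) := by
    simpa using tendsto_one_div_atTop_nhds_zero_nat.add
      (((hpow.const_sub 1).mul_const (Real.logb 2 a)).add (hpow.mul_const (Real.logb 2 b)))
  refine ge_of_tendsto ((continuous_coe_real_ereal.tendsto _).comp hlim) ?_
  filter_upwards [eventually_ge_atTop 1] with n hn
  have hn0 : (0 : ℝ) < n := by exact_mod_cast hn
  have hle := hdiv.natCast_mul_le_of_ratioMoment_le hKL hadd hs ha hb hρ0 hρ1.le hMN hρ hn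
  rw [mul_comm, ← EReal.le_div_iff_mul_le (by exact_mod_cast hn) (EReal.natCast_ne_top n)] at hle
  refine hle.trans_eq ?_
  rw [← EReal.coe_natCast, ← EReal.coe_div, Function.comp_apply, add_div,
    mul_div_cancel_left₀ _ hn0.ne']

lemma le_logb_of_forall_sum_lt (hadd : IsWeaklyAdditive D) (hac : ∀ x y, N x y = 0 → M x y = 0)
    {a : ℝ} (ha : 0 < a) (hlt : ∀ x, ∑ y, M x y * Real.logb 2 (M x y / N x y) < Real.logb 2 a) :
    D X Y M N ≤ (Real.logb 2 a : EReal) := by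
  obtain ⟨b, hb, hMN⟩ := exists_pos_forall_le_mul (p := fun z : X × Y => M z.1 z.2)
    (q := fun z => N z.1 z.2) (fun z => stdSimplex.zero_le _ _) fun z => hac _ _
  have hnats : ∀ x, ∑ y, M x y * Real.log (M x y / N x y) < Real.log a := by
    intro x
    have h := hlt x
    simp only [Real.logb, ← mul_div_assoc, ← sum_div] at h
    rwa [div_lt_div_iff_of_pos_right (Real.log_pos one_lt_two)] at h
  obtain ⟨s, hmoment, hs⟩ := ((eventually_all.2 fun x => eventually_ratioMoment_lt_rpow
    (stdSimplex.zero_le (M x)) (stdSimplex.zero_le (N x)) (hac x) (stdSimplex.sum_eq_one _) ha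
    (hnats x)).and self_mem_nhdsWithin).exists
  have has : 0 < a ^ s := Real.rpow_pos_of_pos ha s
  obtain ⟨x₀, hx₀⟩ := Finite.exists_max fun x => ratioMoment s (M x) (N x) / a ^ s
  refine hdiv.le_logb_of_ratioMoment_le hKL hadd (le_of_lt hs) ha hb ?_
    ((div_lt_one has).2 (hmoment x₀)) (fun x y => hMN (x, y)) fun x => (div_le_iff₀ has).1 (hx₀ x)
  exact div_nonneg (ratioMoment_nonneg (stdSimplex.zero_le _) (stdSimplex.zero_le _) s) has.le

end IsChannelDivergence

end ClassicalChannel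

open ClassicalChannel in
theorem theorem3_general (D : ChannelFunction) (hdiv : IsChannelDivergence D)
    (hadd : IsWeaklyAdditive D) (hKL : ReducesToKL D) (X Y : Type) [Fintype X] [Nonempty X]
    [Fintype Y] [Nonempty Y] (M N : Channel X Y) :
    D X Y M N = univ.sup' univ_nonempty (fun x : X => klDivergence (M x) (N x)) := by
  refine le_antisymm ?_ (sup'_le _ _ fun x _ => hdiv.klDivergence_apply_le hKL M N x)
  by_cases hac : ∀ x y, N x y = 0 → M x y = 0
  · refine EReal.le_of_forall_lt_iff_le.1 fun t ht => ?_
    have hlogb : Real.logb 2 (2 ^ t) = t := Real.logb_rpow two_pos (by norm_num)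
    rw [← hlogb]
    refine hdiv.le_logb_of_forall_sum_lt hKL hadd hac (by positivity) fun x => ?_
    rw [hlogb, ← EReal.coe_lt_coe_iff, ← klDivergence_of_forall_eq_zero (hac x)]
    exact (sup'_lt_iff _).1 ht x (mem_univ x)
  · push Not at hac
    obtain ⟨x, y, hN, hM⟩ := hac
    calc D X Y M N ≤ ⊤ := le_top
      _ = klDivergence (M x) (N x) := (klDivergence_eq_top hN hM).symm
      _ ≤ _ := le_sup' (fun x => klDivergence (M x) (N x)) (mem_univ x)

theorem theorem3 (D : ClassicalChannel.ChannelFunction)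
    (hdiv : ClassicalChannel.IsChannelDivergence D)
    (hadd : ClassicalChannel.IsWeaklyAdditive D)
    (hKL : ClassicalChannel.ReducesToKL D)
    (hcont : ClassicalChannel.IsContinuousInSecond D)
    (X Y : Type) [Fintype X] [Nonempty X] [Fintype Y] [Nonempty Y]
    (M N : ClassicalChannel.Channel X Y) :
    D X Y M N = Finset.univ.sup' Finset.univ_nonempty
      (fun x : X => ClassicalChannel.klDivergence (M x) (N x)) :=
  theorem3_general D hdiv hadd hKL X Y M N
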